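/- Let $\lambda,\mu\in(0,\infty)$ and $0<p\le 1$. A particle starts at the origin of $\mathbb Z$ at time $0$ with no bond between neighbouring sites broken. It attempts to jump at the times of a Poisson process of rate $\lambda$ (independent exponential waiting times of rate $\lambda$). At an attempt, if both bonds next to the particle are intact, it crosses each of them with probability $1/2$; if exactly one of them is broken, it crosses the other one; if both are broken, it stays where it is. Each time a bond is crossed it breaks with probability $p$, and a broken bond is repaired after an exponential time of rate $\mu$; waiting times, directions, breakings and repair times are independent. Let $X(t)$ be the (right-continuous) position of the particle and $b_t$ the number of broken bonds at time $t$, and put $$\sigma_1=\inf\{t>0: b_t>0\},\qquad \tau_1=\inf\{t>\sigma_1: b_t=0\}.$$ Proposition. Let $p=1$. For every $\lambda>0$ there is $\mu_0=\mu_0(\lambda)>0$ such that for all $\mu>\mu_0$ the time $\tau_1$ is almost surely finite, $E(\tau_1)<\infty$, $E(X(\tau_1)^2)<\infty$, and $$E\left(X(\tau_1)^2\right)>\lambda\,E(\tau_1).$$ Consequently, with $\alpha=E(\tau_1)$ and $\beta=\sqrt{\operatorname{Var}X(\tau_1)}$, if $\lambda=1$ then for all $\mu>\mu_0(1)$ the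 diffusion coefficient $\beta/\sqrt{\alpha}$ of the walk satisfies $$\frac{\beta}{\sqrt{\alpha}}>1,$$ that is, it exceeds the value $1$ of the diffusion coefficient of the simple random walk with jump rate $1$. -/

import Mathlib

open MeasureTheory ProbabilityTheory
open scoped NNReal ENNReal

noncomputable section

namespace CollapsingBonds

/-- The randomness attached to one attempt of the particle to jump, in this order:
the waiting time since the previous attempt; the direction of the jump when both neighbouring
bonds are intact (`true` is right); whether the bond that is crossed breaks; and the repair time
of that bond, should it break. -/
abbrev Mark : Type := ℝ × Bool × Bool × ℝ

/-- The fair coin's parameter. -/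
def half : unitInterval := ⟨1 / 2, by norm_num, by norm_num⟩

/-- The law of the randomness of one attempt: independent components, namely an exponential waiting
time of rate `lam`, a fair coin for the direction, a break with probability `p`, and an exponential
repair time of rate `mu`. -/
def markLaw (lam : ℝ) (p : unitInterval) (mu : ℝ) : Measure Mark :=
  (expMeasure lam).prod
    ((bernoulliMeasure true false half).prod
      ((bernoulliMeasure true false p).prod (expMeasure mu)))

/-- The attempts are independent and each has the law `markLaw lam p mu`. -/
structure IsDriving {Ω : Type*} [MeasurableSpace Ω] (P : Measure Ω)
    (lam : ℝ) (p : unitInterval) (mu : ℝ) (D : ℕ → Ω → Mark) : Prop where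
  indep : iIndepFun D P
  law : ∀ n, HasLaw (D n) (markLaw lam p mu) P

/-! Deterministic construction of a trajectory from a sequence `d` of marks. The bond `k : ℤ`
connects the sites `k` and `k + 1`. -/

/-- The time of attempt number `n` (the first attempt has number `0`). -/
def attemptTime (d : ℕ → Mark) (n : ℕ) : ℝ :=
  ∑ i ∈ Finset.range (n + 1), (d i).1

/-- Position of the particle, and for every bond the time at which its last repair is completed
(`0` if it has never broken). At time `t` the bond `k` is broken iff `t < repairedAt k`. -/
structure State where
  pos : ℤ
  repairedAt : ℤ → ℝ

/-- The particle at `s.pos` crosses the bond `k` at time `T` and arrives at `newPos`;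
the bond breaks if the mark says so. -/
def State.cross (s : State) (T : ℝ) (m : Mark) (k newPos : ℤ) : State where
  pos := newPos
  repairedAt := if m.2.2.1 then Function.update s.repairedAt k (T + m.2.2.2) else s.repairedAt

def State.crossRight (s : State) (T : ℝ) (m : Mark) : State :=
  s.cross T m s.pos (s.pos + 1)

def State.crossLeft (s : State) (T : ℝ) (m : Mark) : State :=
  s.cross T m (s.pos - 1) (s.pos - 1)

open Classical in
/-- The effect of an attempt to jump at time `T`. -/
def State.attempt (s : State) (T : ℝ) (m : Mark) : State :=
  if T < s.repairedAt (s.pos - 1) then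
    if T < s.repairedAt s.pos then s else s.crossRight T m
  else
    if T < s.repairedAt s.pos then s.crossLeft T m
    else if m.2.1 then s.crossRight T m else s.crossLeft T m

/-- The state just after the first `n` attempts. -/
def stateAfter (d : ℕ → Mark) : ℕ → State
  | 0 => ⟨0, fun _ => 0⟩
  | n + 1 => (stateAfter d n).attempt (attemptTime d n) (d n)

/-- The number `N(t)` of attempts during `[0, t]` (finite for almost all sequences of marks). -/
def attempts (d : ℕ → Mark) (t : ℝ≥0) : ℕ :=
  {n : ℕ | attemptTime d n ≤ t}.ncard

/-- The position `X(t)` of the particle at time `t`. -/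
def walk (d : ℕ → Mark) (t : ℝ≥0) : ℤ :=
  (stateAfter d (attempts d t)).pos

/-- The number `b_t` of broken bonds at time `t` (it is at most the number of attempts). -/
def broken (d : ℕ → Mark) (t : ℝ≥0) : ℕ :=
  {k : ℤ | (t : ℝ) < (stateAfter d (attempts d t)).repairedAt k}.ncard

/-- `inf {t > s : Q t}`, with value `∞` if there is no such time. -/
def firstAfter (Q : ℝ≥0 → Prop) (s : ℝ≥0∞) : ℝ≥0∞ :=
  sInf {u : ℝ≥0∞ | ∃ t : ℝ≥0, s < t ∧ Q t ∧ u = t}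

/-- `τ_0 = 0`, `σ_{i+1} = inf {t > τ_i : b_t > 0}`, `τ_{i+1} = inf {t > σ_{i+1} : b_t = 0}`. -/
def tau (d : ℕ → Mark) : ℕ → ℝ≥0∞
  | 0 => 0
  | i + 1 => firstAfter (fun t => broken d t = 0) (firstAfter (fun t => 0 < broken d t) (tau d i))

variable {Ω : Type*}

/-- The random time `τ_1` as a real number (with value `0` where it is infinite). -/
def tauOne (D : ℕ → Ω → Mark) (ω : Ω) : ℝ :=
  (tau (fun n => D n ω) 1).toReal

/-- The random position `X(τ_1)` as a real number. -/
def walkAtTauOne (D : ℕ → Ω → Mark) (ω : Ω) : ℝ :=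
  walk (fun n => D n ω) (tau (fun n => D n ω) 1).toNNReal

/-- `α = E(τ_1)`. -/
def alpha [MeasurableSpace Ω] (P : Measure Ω) (D : ℕ → Ω → Mark) : ℝ :=
  ∫ ω, tauOne D ω ∂P

/-- `β`, the nonnegative square root of `Var X(τ_1)`. -/
def beta [MeasurableSpace Ω] (P : Measure Ω) (D : ℕ → Ω → Mark) : ℝ :=
  Real.sqrt (variance (walkAtTauOne D) P)

end CollapsingBonds

end

noncomputable section

namespace CollapsingBonds

/-! Write x = lam / mu, which is small when repairs are fast. A cycle begins with a jump to ±1 that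
breaks the crossed bond. With probability lam / (lam + mu), about x, the next attempt precedes the
repair; the particle must then go on in the same direction, and the squared displacement at τ_1 is 4
instead of 1 unless still more happens. Hence E X(τ_1)² ≥ 1 + 3x - O(x²), while the first wait and
one repair time give lam E τ_1 ≤ 1 + x + O(x²). The gain 3x beats the cost x.

The errors are controlled by a single-server queue: `workload` compares repair times laid end to end
with the waiting times. True repairs run in parallel and some attempts break nothing, so at the
first n with negative workload all bonds are intact before attempt n. Thus τ_1 ≤ `repairTotal d n`
(`tau_le`) and |X(τ_1)| ≤ n (`abs_endPos_le`). By a Chernoff bound (`lintegral_busyAt_le`) the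
workload at n is nonnegative with probability at most `decay` ^ n, where `decay` ≤ 4x. Summing over
n gives integrability and the error terms.

The diffusion coefficient involves the variance, so the mean is needed too: it is O(x) by comparison
with the centred first step (`abs_integral_endPos_le`), and its square is again O(x²). -/

/-- The repair time attached to an attempt. -/
def repairTime (m : Mark) : ℝ := m.2.2.2

/-- A mark with positive times whose crossing breaks the bond. -/
def Mark.Good (m : Mark) : Prop := 0 < m.1 ∧ m.2.2.1 = true ∧ 0 < repairTime m

/-- Excess of the first `n` repair times over the `n` waiting times that follow the first attempt. -/
def workload (d : ℕ → Mark) (n : ℕ) : ℝ :=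
  ∑ j ∈ Finset.range n, (repairTime (d j) - (d (j + 1)).1)

/-- Total of the first `n` repair times, counted from the first attempt. -/
def repairTotal (d : ℕ → Mark) (n : ℕ) : ℝ :=
  attemptTime d 0 + ∑ j ∈ Finset.range n, repairTime (d j)

/-- `n` is the first positive index with negative workload. -/
def IsFirstIdle (d : ℕ → Mark) (n : ℕ) : Prop :=
  1 ≤ n ∧ workload d n < 0 ∧ ∀ i, i < n → 0 ≤ workload d i

/-- The displacement of the first jump. -/
def firstStep (m : Mark) : ℤ := if m.2.1 then 1 else -1

variable {d : ℕ → Mark}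

/-! ### Attempt times, repair totals and the counting of attempts -/

lemma attemptTime_succ (d : ℕ → Mark) (n : ℕ) :
    attemptTime d (n + 1) = attemptTime d n + (d (n + 1)).1 := by
  simp [attemptTime, Finset.sum_range_succ]

lemma attemptTime_strictMono (hd : ∀ n, (d n).Good) : StrictMono (attemptTime d) :=
  strictMono_nat_of_lt_succ fun n => by
    rw [attemptTime_succ]; linarith [(hd (n + 1)).1]

lemma attemptTime_zero (d : ℕ → Mark) : attemptTime d 0 = (d 0).1 := by
  simp [attemptTime]

lemma repairTotal_zero (d : ℕ → Mark) : repairTotal d 0 = attemptTime d 0 := by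
  simp [repairTotal]

lemma repairTotal_succ (d : ℕ → Mark) (n : ℕ) :
    repairTotal d (n + 1) = repairTotal d n + repairTime (d n) := by
  simp [repairTotal, Finset.sum_range_succ, add_assoc]

lemma repairTotal_eq (d : ℕ → Mark) (n : ℕ) :
    repairTotal d n = attemptTime d n + workload d n := by
  induction n with
  | zero => simp [repairTotal, workload]
  | succ n ih =>
    rw [repairTotal_succ, ih, attemptTime_succ, workload, workload, Finset.sum_range_succ]
    ring

lemma repairTotal_strictMono (hd : ∀ n, (d n).Good) : StrictMono (repairTotal d) :=
  strictMono_nat_of_lt_succ fun n => by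
    rw [repairTotal_succ]; linarith [(hd n).2.2]

lemma attempts_eq {t : ℝ≥0} {n : ℕ} (h₁ : ∀ m < n, attemptTime d m ≤ t)
    (h₂ : ∀ m, n ≤ m → (t : ℝ) < attemptTime d m) : attempts d t = n := by
  have : {m : ℕ | attemptTime d m ≤ t} = Set.Iio n := by
    ext m
    simp only [Set.mem_ofPred_eq, Set.mem_Iio]
    refine ⟨fun h => ?_, h₁ m⟩
    by_contra hn
    exact (h₂ m (not_lt.1 hn)).not_ge h
  rw [attempts, this, ← Nat.card_coe_set_eq]
  simp

lemma attempts_eq_zero (hd : ∀ n, (d n).Good) {t : ℝ≥0} (h : (t : ℝ) < attemptTime d 0) :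
    attempts d t = 0 :=
  attempts_eq (by simp) fun m _ => h.trans_le ((attemptTime_strictMono hd).monotone (Nat.zero_le m))

lemma attempts_eq_succ (hd : ∀ n, (d n).Good) {t : ℝ≥0} {n : ℕ} (h₁ : attemptTime d n ≤ t)
    (h₂ : (t : ℝ) < attemptTime d (n + 1)) : attempts d t = n + 1 :=
  attempts_eq
    (fun _ hm => ((attemptTime_strictMono hd).monotone (Nat.lt_succ_iff.1 hm)).trans h₁)
    fun _ hm => h₂.trans_le ((attemptTime_strictMono hd).monotone hm)

lemma attempts_eq_sInf (hd : ∀ n, (d n).Good) (t : ℝ≥0) :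
    attempts d t = sInf {n | (t : ℝ) < attemptTime d n} := by
  by_cases h : ∃ n, (t : ℝ) < attemptTime d n
  · have hmem := Nat.sInf_mem (s := {n | (t : ℝ) < attemptTime d n}) h
    refine attempts_eq (fun m hm => ?_) fun m hm =>
      lt_of_lt_of_le hmem ((attemptTime_strictMono hd).monotone hm)
    exact not_lt.1 fun hlt => Nat.notMem_of_lt_sInf hm hlt
  -- If no attempt comes after t, both sides take the default value 0: `sInf ∅`, and `ncard` of an
  -- infinite set. So non-explosion is not needed.
  · push Not at h
    have e₁ : {n | (t : ℝ) < attemptTime d n} = ∅ := by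
      ext n; simpa using h n
    have e₂ : {n | attemptTime d n ≤ (t : ℝ)} = Set.univ := by
      ext n; simpa using h n
    rw [attempts, e₁, e₂, Nat.sInf_empty, Set.ncard_univ, Nat.card_eq_zero_of_infinite]

/-! ### States reached along a trajectory -/

lemma repairedAt_cross (s : State) (T : ℝ) (m : Mark) (k p j : ℤ) :
    (s.cross T m k p).repairedAt j = s.repairedAt j ∨
      (s.cross T m k p).repairedAt j = T + repairTime m ∧ j = k := by
  unfold State.cross repairTime
  by_cases hm : m.2.2.1 = true
  · by_cases hj : j = k
    · subst hj; simp [hm]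
    · left; simp [hm, hj]
  · simp [hm]

lemma attempt_cases (s : State) (T : ℝ) (m : Mark) :
    s.attempt T m = s ∨ s.attempt T m = s.crossRight T m ∨ s.attempt T m = s.crossLeft T m := by
  unfold State.attempt
  split_ifs <;> simp

lemma repairedAt_attempt (s : State) (T : ℝ) (m : Mark) : ∃ k, ∀ j,
    (s.attempt T m).repairedAt j = s.repairedAt j ∨
      (s.attempt T m).repairedAt j = T + repairTime m ∧ j = k := by
  rcases attempt_cases s T m with h | h | h <;> rw [h]
  · exact ⟨0, fun j => .inl rfl⟩
  · exact ⟨_, fun j => repairedAt_cross _ _ _ _ _ _⟩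
  · exact ⟨_, fun j => repairedAt_cross _ _ _ _ _ _⟩

lemma repairedAt_stateAfter (d : ℕ → Mark) (n : ℕ) (k : ℤ) :
    (stateAfter d n).repairedAt k = 0 ∨
      ∃ j < n, (stateAfter d n).repairedAt k = attemptTime d j + repairTime (d j) := by
  induction n with
  | zero => left; rfl
  | succ n ih =>
    obtain ⟨k', hk'⟩ := repairedAt_attempt (stateAfter d n) (attemptTime d n) (d n)
    change ((stateAfter d n).attempt (attemptTime d n) (d n)).repairedAt k = 0 ∨ ∃ j < n + 1,
      ((stateAfter d n).attempt (attemptTime d n) (d n)).repairedAt k = _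
    rcases hk' k with h | h
    · rw [h]
      rcases ih with ih | ⟨j, hj, ih⟩
      · exact .inl ih
      · exact .inr ⟨j, by omega, ih⟩
    · exact .inr ⟨n, by omega, h.1⟩

/-- `Set.ncard` vanishes on infinite sets, so finiteness is needed to read `broken d t = 0` as the
absence of broken bonds. -/
lemma finite_repairedAt_ne_zero (d : ℕ → Mark) (n : ℕ) :
    {k | (stateAfter d n).repairedAt k ≠ 0}.Finite := by
  induction n with
  | zero => simp [stateAfter]
  | succ n ih =>
    obtain ⟨k', hk'⟩ := repairedAt_attempt (stateAfter d n) (attemptTime d n) (d n)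
    refine (ih.insert k').subset fun k hk => ?_
    rcases hk' k with h | h
    · refine .inr ?_
      change (stateAfter d n).repairedAt k ≠ 0
      rw [← h]; exact hk
    · exact .inl h.2

lemma abs_pos_stateAfter_le (d : ℕ → Mark) (n : ℕ) : |(stateAfter d n).pos| ≤ n := by
  induction n with
  | zero => simp [stateAfter]
  | succ n ih =>
    change |((stateAfter d n).attempt (attemptTime d n) (d n)).pos| ≤ _
    rw [abs_le] at *
    push_cast
    rcases attempt_cases (stateAfter d n) (attemptTime d n) (d n) with h | h | h <;> rw [h]
    · constructor <;> linarith
    · change -((n : ℤ) + 1) ≤ (stateAfter d n).pos + 1 ∧ (stateAfter d n).pos + 1 ≤ n + 1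
      constructor <;> linarith
    · change -((n : ℤ) + 1) ≤ (stateAfter d n).pos - 1 ∧ (stateAfter d n).pos - 1 ≤ n + 1
      constructor <;> linarith

lemma broken_eq_zero_iff (d : ℕ → Mark) (t : ℝ≥0) :
    broken d t = 0 ↔ ∀ k, (stateAfter d (attempts d t)).repairedAt k ≤ t := by
  have hfin : {k : ℤ | (t : ℝ) < (stateAfter d (attempts d t)).repairedAt k}.Finite := by
    refine (finite_repairedAt_ne_zero d (attempts d t)).subset fun k hk => ?_
    exact (lt_of_le_of_lt t.2 hk).ne'
  rw [broken, Set.ncard_eq_zero hfin, Set.eq_empty_iff_forall_notMem]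
  simp

lemma stateAfter_one (hd : ∀ n, (d n).Good) :
    stateAfter d 1 = ⟨firstStep (d 0), Function.update (fun _ => 0)
      (if (d 0).2.1 then 0 else -1) (attemptTime d 0 + repairTime (d 0))⟩ := by
  have h0 : ¬ attemptTime d 0 < 0 := by
    rw [attemptTime_zero]; exact (hd 0).1.le.not_gt
  have hb := (hd 0).2.1
  simp only [stateAfter, State.attempt, h0, if_false, firstStep]
  by_cases h : (d 0).2.1 = true <;>
    simp [h, State.crossRight, State.crossLeft, State.cross, hb, repairTime]

/-- The bond just crossed is still broken and the one ahead has never been crossed, so the second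
jump repeats the direction of the first. -/
lemma abs_pos_stateAfter_two (hd : ∀ n, (d n).Good)
    (h : attemptTime d 1 < attemptTime d 0 + repairTime (d 0)) :
    |(stateAfter d 2).pos| = 2 := by
  have h1 : ¬ attemptTime d 1 < 0 := by
    have := attemptTime_strictMono hd (show 0 < 1 by norm_num)
    have := (hd 0).1
    rw [← attemptTime_zero] at this
    linarith
  rw [stateAfter, stateAfter_one hd]
  by_cases hb : (d 0).2.1 = true
  · simp [State.attempt, firstStep, hb, h, h1, State.crossRight, State.cross]
  · simp [State.attempt, firstStep, hb, h, h1, State.crossLeft, State.cross]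

lemma broken_pos_of_mem_first (hd : ∀ n, (d n).Good) {t : ℝ≥0} (h₀ : attemptTime d 0 ≤ t)
    (h₁ : (t : ℝ) < attemptTime d 1) (h₂ : (t : ℝ) < attemptTime d 0 + repairTime (d 0)) :
    0 < broken d t := by
  refine Nat.pos_of_ne_zero fun h => ?_
  rw [broken_eq_zero_iff, attempts_eq_succ hd h₀ h₁, stateAfter_one hd] at h
  have := h (if (d 0).2.1 then 0 else -1)
  simp only [Function.update_self] at this
  linarith

lemma broken_eq_zero_of_lt (hd : ∀ n, (d n).Good) {t : ℝ≥0} (h : (t : ℝ) < attemptTime d 0) :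
    broken d t = 0 := by
  rw [broken_eq_zero_iff, attempts_eq_zero hd h]
  exact fun _ => t.2

/-! ### Pathwise control of τ_1 and X(τ_1) by the queue -/

lemma firstAfter_le {Q : ℝ≥0 → Prop} {s : ℝ≥0∞} {t : ℝ≥0} (h : s < t) (hQ : Q t) :
    firstAfter Q s ≤ t :=
  sInf_le ⟨t, h, hQ, rfl⟩

lemma le_firstAfter {Q : ℝ≥0 → Prop} {s a : ℝ≥0∞} (h : ∀ t : ℝ≥0, s < t → Q t → a ≤ t) :
    a ≤ firstAfter Q s :=
  le_sInf fun _ ⟨t, hs, hQ, hu⟩ => hu ▸ h t hs hQ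

/-- The first bond breaks at the first attempt. -/
lemma firstAfter_broken (hd : ∀ n, (d n).Good) :
    firstAfter (fun t => 0 < broken d t) 0 = ENNReal.ofReal (attemptTime d 0) := by
  have h0 : 0 < attemptTime d 0 := by rw [attemptTime_zero]; exact (hd 0).1
  apply le_antisymm
  · refine firstAfter_le (by simpa using h0) ?_
    have hc : ((attemptTime d 0).toNNReal : ℝ) = attemptTime d 0 := Real.coe_toNNReal _ h0.le
    apply broken_pos_of_mem_first hd
    · rw [hc]
    · rw [hc]; exact attemptTime_strictMono hd (by norm_num)
    · rw [hc]; linarith [(hd 0).2.2]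
  · refine le_firstAfter fun t _ hQ => ?_
    by_contra hlt
    rw [not_le, ENNReal.lt_ofReal_iff_toReal_lt (by simp)] at hlt
    exact hQ.ne' (broken_eq_zero_of_lt hd (by simpa using hlt))

lemma tau_one_eq (hd : ∀ n, (d n).Good) :
    tau d 1 = firstAfter (fun t => broken d t = 0) (ENNReal.ofReal (attemptTime d 0)) := by
  simp only [tau, firstAfter_broken hd]

lemma attemptTime_zero_le_tau (hd : ∀ n, (d n).Good) :
    ENNReal.ofReal (attemptTime d 0) ≤ tau d 1 := by
  rw [tau_one_eq hd]
  exact le_firstAfter fun t h _ => h.le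

lemma attemptTime_one_le_tau (hd : ∀ n, (d n).Good)
    (h : attemptTime d 1 < attemptTime d 0 + repairTime (d 0)) :
    ENNReal.ofReal (attemptTime d 1) ≤ tau d 1 := by
  rw [tau_one_eq hd]
  refine le_firstAfter fun t h0 hQ => ?_
  by_contra hlt
  rw [not_le, ENNReal.lt_ofReal_iff_toReal_lt (by simp)] at hlt
  simp only [ENNReal.coe_toReal] at hlt
  refine (broken_pos_of_mem_first hd ?_ hlt (hlt.trans h)).ne' hQ
  exact Real.toNNReal_le_iff_le_coe.1 (ENNReal.coe_le_coe.1 h0.le)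

lemma attemptTime_le_repairTotal {n : ℕ} (hn : ∀ i, i < n → 0 ≤ workload d i) {j : ℕ} (hj : j < n) :
    attemptTime d j ≤ repairTotal d j := by
  rw [repairTotal_eq]; linarith [hn j hj]

/-- Broken bonds are gone by the total of the repair times of the first busy period. -/
lemma tau_le (hd : ∀ n, (d n).Good) {n : ℕ} (hn : IsFirstIdle d n) :
    tau d 1 ≤ ENNReal.ofReal (repairTotal d n) := by
  obtain ⟨n1, hneg, hnn⟩ := hn
  have h0 : 0 < attemptTime d 0 := by rw [attemptTime_zero]; exact (hd 0).1
  have hlt : attemptTime d 0 < repairTotal d n := by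
    rw [← repairTotal_zero]; exact repairTotal_strictMono hd n1
  have hc : ((repairTotal d n).toNNReal : ℝ) = repairTotal d n :=
    Real.coe_toNNReal _ (h0.trans hlt).le
  rw [tau_one_eq hd]
  refine firstAfter_le ((ENNReal.ofReal_lt_ofReal_iff (h0.trans hlt)).2 hlt) ?_
  obtain ⟨m, rfl⟩ : ∃ m, n = m + 1 := ⟨n - 1, by omega⟩
  -- Nonnegative workload before m + 1 puts attempts 0, …, m before this time; negative workload at
  -- m + 1 puts the next attempt strictly after it.
  have ha : attempts d (repairTotal d (m + 1)).toNNReal = m + 1 := by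
    apply attempts_eq_succ hd
    · rw [hc]
      exact (attemptTime_le_repairTotal hnn (Nat.lt_succ_self m)).trans
        (repairTotal_strictMono hd (Nat.lt_succ_self m)).le
    · rw [hc, repairTotal_eq]; linarith
  rw [broken_eq_zero_iff, ha, hc]
  intro k
  -- A repair started at attempt j ends no later than it would with a server handling one repair at
  -- a time.
  rcases repairedAt_stateAfter d (m + 1) k with h | ⟨j, hj, h⟩
  · rw [h]; linarith
  · rw [h]
    calc _ ≤ repairTotal d j + repairTime (d j) := by
          linarith [attemptTime_le_repairTotal hnn hj]
      _ = repairTotal d (j + 1) := (repairTotal_succ _ _).symm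
      _ ≤ _ := (repairTotal_strictMono hd).monotone hj

lemma tau_lt_top (hd : ∀ n, (d n).Good) {n : ℕ} (hn : IsFirstIdle d n) : tau d 1 < ∞ :=
  (tau_le hd hn).trans_lt ENNReal.ofReal_lt_top

lemma toReal_tau_le (hd : ∀ n, (d n).Good) {n : ℕ} (hn : IsFirstIdle d n) :
    (tau d 1).toReal ≤ repairTotal d n := by
  refine ENNReal.toReal_le_of_le_ofReal ?_ (tau_le hd hn)
  have h0 : 0 < attemptTime d 0 := by rw [attemptTime_zero]; exact (hd 0).1
  rw [← repairTotal_zero] at h0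
  exact (h0.trans (repairTotal_strictMono hd hn.1)).le

lemma toReal_tau_lt (hd : ∀ n, (d n).Good) {n : ℕ} (hn : IsFirstIdle d n) :
    (tau d 1).toReal < attemptTime d n := by
  refine (toReal_tau_le hd hn).trans_lt ?_
  rw [repairTotal_eq]; linarith [hn.2.1]

lemma attemptTime_zero_le_toReal_tau (hd : ∀ n, (d n).Good) {n : ℕ} (hn : IsFirstIdle d n) :
    attemptTime d 0 ≤ (tau d 1).toReal :=
  (ENNReal.ofReal_le_iff_le_toReal (tau_lt_top hd hn).ne).1 (attemptTime_zero_le_tau hd)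

/-- The position at `τ_1`. -/
def endPos (d : ℕ → Mark) : ℤ := walk d (tau d 1).toNNReal

lemma abs_endPos_le (hd : ∀ n, (d n).Good) {n : ℕ} (hn : IsFirstIdle d n) :
    |endPos d| ≤ n := by
  refine (abs_pos_stateAfter_le d _).trans ?_
  rw [attempts_eq_sInf hd]
  exact_mod_cast Nat.sInf_le (toReal_tau_lt hd hn)

lemma endPos_eq_firstStep (hd : ∀ n, (d n).Good) (h : workload d 1 < 0) :
    endPos d = firstStep (d 0) := by
  have hn : IsFirstIdle d 1 := ⟨le_rfl, h, fun i hi => by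
    obtain rfl : i = 0 := by omega
    simp [workload]⟩
  rw [endPos, walk, attempts_eq_succ hd (attemptTime_zero_le_toReal_tau hd hn)
    (toReal_tau_lt hd hn), stateAfter_one hd]

/-- Positive workload at 1 forces the second jump before τ_1; negative workload at 2 ends the cycle
before a third attempt. -/
lemma abs_endPos_eq_two (hd : ∀ n, (d n).Good) (h₁ : 0 < workload d 1) (h₂ : workload d 2 < 0) :
    |endPos d| = 2 := by
  have hn : IsFirstIdle d 2 := ⟨by norm_num, h₂, fun i hi => by
    interval_cases i
    · simp [workload]
    · exact h₁.le⟩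
  have hlt : attemptTime d 1 < attemptTime d 0 + repairTime (d 0) := by
    have := repairTotal_eq d 1
    rw [repairTotal_succ, repairTotal_zero] at this
    linarith
  rw [endPos, walk, attempts_eq_succ hd
    ((ENNReal.ofReal_le_iff_le_toReal (tau_lt_top hd hn).ne).1 (attemptTime_one_le_tau hd hlt))
    (toReal_tau_lt hd hn), abs_pos_stateAfter_two hd hlt]

/-! ### Measurability of τ_1 and X(τ_1) -/

lemma measurable_repairTime : Measurable repairTime := by unfold repairTime; fun_prop

lemma measurable_attemptTime (n : ℕ) : Measurable fun d : ℕ → Mark => attemptTime d n := by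
  unfold attemptTime; fun_prop

lemma measurable_workload (n : ℕ) : Measurable fun d : ℕ → Mark => workload d n := by
  have := measurable_repairTime
  unfold workload; fun_prop

lemma measurable_eval_int {α : Type*} [MeasurableSpace α] {f : α → ℤ → ℝ} {k : α → ℤ}
    (hf : ∀ j, Measurable fun a => f a j) (hk : Measurable k) : Measurable fun a => f a (k a) := by
  have : Measurable fun p : α × ℤ => f p.1 p.2 := measurable_from_prod_countable_left hf
  exact this.comp (measurable_id.prodMk hk)

/-- A random state all of whose coordinates are measurable. -/
def MeasurableState {α : Type*} [MeasurableSpace α] (s : α → State) : Prop :=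
  (Measurable fun a => (s a).pos) ∧ ∀ k, Measurable fun a => (s a).repairedAt k

section

variable {α : Type*} [MeasurableSpace α] {s s' : α → State} {T : α → ℝ} {m : α → Mark}

lemma MeasurableState.ite {p : α → Prop} [DecidablePred p] (hp : MeasurableSet {a | p a})
    (hs : MeasurableState s) (hs' : MeasurableState s') :
    MeasurableState fun a => if p a then s a else s' a := by
  refine ⟨?_, fun k => ?_⟩
  · simp only [apply_ite State.pos]
    exact hs.1.ite hp hs'.1
  · have : ∀ a, (if p a then s a else s' a).repairedAt k
        = if p a then (s a).repairedAt k else (s' a).repairedAt k := fun a => by split_ifs <;> rfl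
    simp only [this]
    exact (hs.2 k).ite hp (hs'.2 k)

lemma MeasurableState.cross (hs : MeasurableState s) (hT : Measurable T) (hm : Measurable m)
    {k p : α → ℤ} (hk : Measurable k) (hp : Measurable p) :
    MeasurableState fun a => (s a).cross (T a) (m a) (k a) (p a) := by
  refine ⟨hp, fun j => ?_⟩
  have : ∀ a, ((s a).cross (T a) (m a) (k a) (p a)).repairedAt j
      = if (m a).2.2.1 = true ∧ j = k a then T a + (m a).2.2.2 else (s a).repairedAt j := by
    intro a
    unfold State.cross
    by_cases h : (m a).2.2.1 = true <;> by_cases hj : j = k a <;> simp [h, hj]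
  simp only [this]
  refine Measurable.ite (.inter ?_ ?_) (by fun_prop) (hs.2 j)
  · exact measurableSet_eq_fun (by fun_prop) measurable_const
  · exact measurableSet_eq_fun measurable_const hk

lemma MeasurableState.attempt (hs : MeasurableState s) (hT : Measurable T) (hm : Measurable m) :
    MeasurableState fun a => (s a).attempt (T a) (m a) := by
  classical
  have hpos := hs.1
  have hl : MeasurableSet {a | T a < (s a).repairedAt ((s a).pos - 1)} :=
    measurableSet_lt hT (measurable_eval_int hs.2 (by fun_prop))
  have hr : MeasurableSet {a | T a < (s a).repairedAt (s a).pos} :=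
    measurableSet_lt hT (measurable_eval_int hs.2 hpos)
  have hR : MeasurableState fun a => (s a).crossRight (T a) (m a) :=
    hs.cross hT hm hpos (by fun_prop)
  have hL : MeasurableState fun a => (s a).crossLeft (T a) (m a) :=
    hs.cross hT hm (by fun_prop) (by fun_prop)
  have hd : MeasurableSet {a | (m a).2.1 = true} :=
    measurableSet_eq_fun (by fun_prop) measurable_const
  exact .ite hl (.ite hr hs hR) (.ite hr hL (.ite hd hR hL))

end

lemma measurableState_stateAfter (n : ℕ) :
    MeasurableState fun d : ℕ → Mark => stateAfter d n := by
  induction n with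
  | zero => exact ⟨measurable_const, fun _ => measurable_const⟩
  | succ n ih => exact ih.attempt (measurable_attemptTime n) (measurable_pi_apply n)

/-- The first attempt after time `t`. -/
def nextAttempt (d : ℕ → Mark) (t : ℝ) : ℕ := sInf {n | t < attemptTime d n}

lemma measurable_nextAttempt {t : (ℕ → Mark) → ℝ} (ht : Measurable t) :
    Measurable fun d => nextAttempt d (t d) := by
  refine measurable_of_Iio fun n => ?_
  -- The second set accounts for the default value 0 of `sInf`, taken when no attempt comes after `t
  -- d`.
  have : (fun d => nextAttempt d (t d)) ⁻¹' Set.Iio n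
      = {d | ∃ m < n, t d < attemptTime d m} ∪ {d | 0 < n ∧ ∀ m, attemptTime d m ≤ t d} := by
    ext d
    simp only [Set.mem_preimage, Set.mem_Iio, Set.mem_union, Set.mem_ofPred_eq, nextAttempt]
    by_cases h : ∃ m, t d < attemptTime d m
    · have hno : ¬ (0 < n ∧ ∀ m, attemptTime d m ≤ t d) := fun h' => by
        obtain ⟨m, hm⟩ := h
        exact (h'.2 m).not_gt hm
      simp only [hno, or_false]
      exact ⟨fun hlt => ⟨_, hlt, Nat.sInf_mem (s := {n | t d < attemptTime d n}) h⟩,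
        fun ⟨m, hm, hlt⟩ => (Nat.sInf_le hlt).trans_lt hm⟩
    · push Not at h
      have e : {n | t d < attemptTime d n} = ∅ := by
        ext n; simpa using h n
      rw [e, Nat.sInf_empty]
      constructor
      · exact fun h0 => .inr ⟨h0, h⟩
      · rintro (⟨m, -, hm⟩ | h')
        · exact absurd hm (h m).not_gt
        · exact h'.1
  rw [this]
  refine .union ?_ ?_
  · rw [Set.ofPred_exists]
    exact .iUnion fun m =>
      (MeasurableSet.const (m < n)).inter (measurableSet_lt ht (measurable_attemptTime m))
  · refine (MeasurableSet.const (0 < n)).inter ?_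
    change MeasurableSet {d | ∀ m, attemptTime d m ≤ t d}
    rw [Set.ofPred_forall]
    exact .iInter fun m => measurableSet_le (measurable_attemptTime m) ht

lemma measurable_comp_nat {α β : Type*} [MeasurableSpace α] [MeasurableSpace β] {f : α → ℕ → β}
    {k : α → ℕ} (hf : ∀ j, Measurable fun a => f a j) (hk : Measurable k) :
    Measurable fun a => f a (k a) := by
  have : Measurable fun p : α × ℕ => f p.1 p.2 := measurable_from_prod_countable_left hf
  exact this.comp (measurable_id.prodMk hk)

/-- No bond is broken at time `t`. -/
def AllRepaired (d : ℕ → Mark) (t : ℝ) : Prop :=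
  ∀ k, (stateAfter d (nextAttempt d t)).repairedAt k ≤ t

lemma measurableSet_allRepaired (t : ℝ) : MeasurableSet {d | AllRepaired d t} := by
  unfold AllRepaired
  simp only [Set.ofPred_forall]
  refine .iInter fun k => measurableSet_le ?_ measurable_const
  exact measurable_comp_nat (fun n => (measurableState_stateAfter n).2 k)
    (measurable_nextAttempt measurable_const)

lemma broken_eq_zero_iff_allRepaired {d : ℕ → Mark} (hd : ∀ n, (d n).Good) (t : ℝ≥0) :
    broken d t = 0 ↔ AllRepaired d t := by
  rw [broken_eq_zero_iff, attempts_eq_sInf hd]; rfl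

/-- After a time without broken bonds there are none for a while. -/
lemma exists_allRepaired_Ico {d : ℕ → Mark} {t : ℝ}
    (h : AllRepaired d t) : ∃ u, t < u ∧ ∀ v, t ≤ v → v < u → AllRepaired d v := by
  have key : ∃ u, t < u ∧ ∀ v, t ≤ v → v < u → nextAttempt d v = nextAttempt d t := by
    by_cases hex : ∃ m, t < attemptTime d m
    · have hmem := Nat.sInf_mem (s := {n | t < attemptTime d n}) hex
      refine ⟨_, hmem, fun v hv hvu => le_antisymm (Nat.sInf_le hvu) ?_⟩
      refine Nat.sInf_le ?_
      exact hv.trans_lt (Nat.sInf_mem (s := {n | v < attemptTime d n}) ⟨_, hvu⟩)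
    · push Not at hex
      refine ⟨t + 1, by linarith, fun v hv _ => ?_⟩
      have e : ∀ v, t ≤ v → {n | v < attemptTime d n} = ∅ := fun v hv => by
        ext n; simpa using (hex n).trans hv
      rw [nextAttempt, nextAttempt, e v hv, e t le_rfl]
  obtain ⟨u, htu, hu⟩ := key
  refine ⟨u, htu, fun v hv hvu k => ?_⟩
  rw [hu v hv hvu]
  exact (h k).trans hv

open Classical in
/-- The infimum that defines `τ_1`, restricted to rational times. -/
def tauRat (d : ℕ → Mark) : ℝ≥0∞ :=
  ⨅ q : ℚ, if attemptTime d 0 < (Real.toNNReal q : ℝ) ∧ AllRepaired d (Real.toNNReal q : ℝ)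
    then (Real.toNNReal q : ℝ≥0∞) else ∞

lemma measurable_tauRat : Measurable tauRat := by
  unfold tauRat
  refine .iInf fun q => Measurable.ite (.inter ?_ ?_) measurable_const measurable_const
  · exact measurableSet_lt (measurable_attemptTime 0) measurable_const
  · exact measurableSet_allRepaired _

/-- Absence of broken bonds persists for a while to the right, so every admissible time is a limit
of admissible rational times. -/
lemma tau_one_eq_tauRat {d : ℕ → Mark} (hd : ∀ n, (d n).Good) : tau d 1 = tauRat d := by
  classical
  have h0 : 0 ≤ attemptTime d 0 := by rw [attemptTime_zero]; exact (hd 0).1.le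
  rw [tau_one_eq hd]
  apply le_antisymm
  · refine le_iInf fun q => ?_
    split_ifs with h
    · refine firstAfter_le ?_ ((broken_eq_zero_iff_allRepaired hd _).2 h.2)
      rw [ENNReal.ofReal_lt_iff_lt_toReal h0 (by simp)]
      exact h.1
    · exact le_top
  · refine le_firstAfter fun t ht hQ => ?_
    rw [broken_eq_zero_iff_allRepaired hd] at hQ
    obtain ⟨u, htu, hu⟩ := exists_allRepaired_Ico hQ
    refine le_of_forall_gt fun c hc => ?_
    have hu0 : (t : ℝ≥0∞) < ENNReal.ofReal u := by
      rw [ENNReal.lt_ofReal_iff_toReal_lt (by simp)]; simpa using htu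
    obtain ⟨q, -, hq0, hq⟩ := ENNReal.lt_iff_exists_rat_btwn.1 (lt_min hc hu0)
    refine (iInf_le _ q).trans_lt ?_
    rw [if_pos]
    · exact (lt_min_iff.1 hq).1
    · have h1 := (lt_min_iff.1 hq).2
      rw [ENNReal.lt_ofReal_iff_toReal_lt (by simp)] at h1
      have h2 : (t : ℝ) < (Real.toNNReal q : ℝ) := by exact_mod_cast hq0
      refine ⟨?_, hu _ h2.le (by simpa using h1)⟩
      refine lt_of_le_of_lt ?_ h2
      exact Real.toNNReal_le_iff_le_coe.1 (ENNReal.coe_le_coe.1 ht.le)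

/-- A measurable version of `endPos`. -/
def endPosRat (d : ℕ → Mark) : ℤ := (stateAfter d (nextAttempt d (tauRat d).toReal)).pos

lemma measurable_endPosRat : Measurable endPosRat :=
  measurable_comp_nat (fun n => (measurableState_stateAfter n).1)
    (measurable_nextAttempt measurable_tauRat.ennreal_toReal)

lemma endPos_eq_endPosRat {d : ℕ → Mark} (hd : ∀ n, (d n).Good) : endPos d = endPosRat d := by
  rw [endPos, walk, attempts_eq_sInf hd, endPosRat, ← tau_one_eq_tauRat hd]; rfl

/-! Integrals against exponential laws. -/

instance isProbabilityMeasure_expMeasure_of_fact {r : ℝ} [hr : Fact (0 < r)] :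
    IsProbabilityMeasure (expMeasure r) :=
  isProbabilityMeasure_expMeasure hr.out

instance nullSingletonClass_expMeasure {r : ℝ} : NullSingletonClass (expMeasure r) := by
  unfold expMeasure gammaMeasure; infer_instance

lemma measurable_gammaPDF (a r : ℝ) : Measurable (gammaPDF a r) :=
  (measurable_gammaPDFReal a r).ennreal_ofReal

lemma lintegral_expMeasure (r : ℝ) {f : ℝ → ℝ≥0∞} (hf : Measurable f) :
    ∫⁻ x, f x ∂expMeasure r = ∫⁻ x, exponentialPDF r x * f x := by
  rw [expMeasure, gammaMeasure, lintegral_withDensity_eq_lintegral_mul _ (measurable_gammaPDF 1 r) hf]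
  rfl

/-- Exponential tilting: the weighted density is a multiple of the exponential density of rate r -
θ. -/
lemma lintegral_exp_expMeasure {r θ : ℝ} (hr : 0 < r) (hθ : θ < r) :
    ∫⁻ x, ENNReal.ofReal (Real.exp (θ * x)) ∂expMeasure r = ENNReal.ofReal (r / (r - θ)) := by
  have h0 : 0 < r - θ := by linarith
  rw [lintegral_expMeasure r (by fun_prop)]
  have : ∀ x, exponentialPDF r x * ENNReal.ofReal (Real.exp (θ * x))
      = ENNReal.ofReal (r / (r - θ)) * exponentialPDF (r - θ) x := by
    intro x
    rcases lt_or_ge x 0 with hx | hx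
    · simp [exponentialPDF_of_neg hx]
    · rw [exponentialPDF_of_nonneg hx, exponentialPDF_of_nonneg hx,
        ← ENNReal.ofReal_mul (by positivity), ← ENNReal.ofReal_mul (by positivity)]
      congr 1
      rw [show -((r - θ) * x) = -(r * x) + θ * x by ring, Real.exp_add]
      field_simp
  simp_rw [this]
  rw [lintegral_const_mul _ (show Measurable (exponentialPDF (r - θ)) from measurable_gammaPDF 1 _),
    lintegral_exponentialPDF_eq_one h0, mul_one]

/-- Multiplying the density by x gives 1 / r times a Gamma density of shape 2. -/
lemma lintegral_id_expMeasure {r : ℝ} (hr : 0 < r) :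
    ∫⁻ x, ENNReal.ofReal x ∂expMeasure r = ENNReal.ofReal (1 / r) := by
  rw [lintegral_expMeasure r (by fun_prop)]
  have : ∀ x, exponentialPDF r x * ENNReal.ofReal x
      = ENNReal.ofReal (1 / r) * gammaPDF 2 r x := by
    intro x
    rcases lt_or_ge x 0 with hx | hx
    · simp [exponentialPDF_of_neg hx, gammaPDF_of_neg hx]
    · rw [exponentialPDF_of_nonneg hx, gammaPDF_of_nonneg hx,
        ← ENNReal.ofReal_mul (by positivity), ← ENNReal.ofReal_mul (by positivity)]
      congr 1
      rw [show (2 : ℝ) - 1 = 1 by norm_num, Real.rpow_one, Real.rpow_two,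
        show Real.Gamma 2 = 1 by exact Real.Gamma_two]
      field_simp
  simp_rw [this]
  rw [lintegral_const_mul _ (measurable_gammaPDF 2 _), lintegral_gammaPDF_eq_one two_pos hr,
    mul_one]

lemma expMeasure_Ioi {r : ℝ} (hr : 0 < r) {t : ℝ} (ht : 0 ≤ t) :
    expMeasure r (Set.Ioi t) = ENNReal.ofReal (Real.exp (-r * t)) := by
  have : Fact (0 < r) := ⟨hr⟩
  have h := cdf_expMeasure_eq hr t
  rw [cdf_eq_real, if_pos ht] at h
  rw [← ofReal_measureReal, ← Set.compl_Iic, probReal_compl_eq_one_sub measurableSet_Iic, h]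
  ring_nf

lemma ae_pos_expMeasure {r : ℝ} (hr : 0 < r) : ∀ᵐ x ∂expMeasure r, 0 < x := by
  have : Fact (0 < r) := ⟨hr⟩
  have h := expMeasure_Ioi hr le_rfl
  simp only [mul_zero, Real.exp_zero, ENNReal.ofReal_one] at h
  exact (prob_compl_eq_zero_iff measurableSet_Ioi).2 h

/-- Given the first variable x, the second exceeds it with probability exp (-mu x); its mean is an
exponential moment of the first law. -/
lemma prod_expMeasure_lt {lam mu : ℝ} (hlam : 0 < lam) (hmu : 0 < mu) :
    ((expMeasure lam).prod (expMeasure mu)) {z | z.1 < z.2} = ENNReal.ofReal (lam / (lam + mu)) := by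
  have : Fact (0 < lam) := ⟨hlam⟩
  have : Fact (0 < mu) := ⟨hmu⟩
  rw [Measure.prod_apply (measurableSet_lt measurable_fst measurable_snd),
    show lam / (lam + mu) = lam / (lam - -mu) by ring,
    ← lintegral_exp_expMeasure hlam (θ := -mu) (by linarith)]
  refine lintegral_congr_ae ?_
  filter_upwards [ae_pos_expMeasure hlam] with x hx
  exact expMeasure_Ioi hmu hx.le

lemma prod_expMeasure_le {lam mu : ℝ} (hlam : 0 < lam) (hmu : 0 < mu) :
    ((expMeasure lam).prod (expMeasure mu)) {z | z.1 ≤ z.2} = ENNReal.ofReal (lam / (lam + mu)) := by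
  have : Fact (0 < lam) := ⟨hlam⟩
  have : Fact (0 < mu) := ⟨hmu⟩
  rw [Measure.prod_apply (measurableSet_le measurable_fst measurable_snd),
    show lam / (lam + mu) = lam / (lam - -mu) by ring,
    ← lintegral_exp_expMeasure hlam (θ := -mu) (by linarith)]
  refine lintegral_congr_ae ?_
  filter_upwards [ae_pos_expMeasure hlam] with x hx
  rw [← expMeasure_Ioi hmu hx.le]
  exact (measure_congr Ioi_ae_eq_Ici).symm

/-! The law of one mark and of the sequence of marks, with `p = 1`. -/

section

variable {lam mu : ℝ} [hmu : Fact (0 < mu)]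

lemma hasLaw_wait {p : unitInterval} :
    HasLaw (fun m : Mark => m.1) (expMeasure lam) (markLaw lam p mu) :=
  MeasurePreserving.hasLaw measurePreserving_fst

lemma lintegral_markLaw {p : unitInterval} {f g : ℝ → ℝ≥0∞} (hf : Measurable f)
    (hg : Measurable g) :
    ∫⁻ m, f m.1 * g (repairTime m) ∂markLaw lam p mu
      = (∫⁻ x, f x ∂expMeasure lam) * ∫⁻ x, g x ∂expMeasure mu := by
  rw [markLaw]
  refine (lintegral_prod_mul (g := fun z : Bool × Bool × ℝ => g z.2.2) hf.aemeasurable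
    (by fun_prop)).trans ?_
  congr 1
  exact (MeasurePreserving.hasLaw ((measurePreserving_snd (μ := bernoulliMeasure true false p)
    (ν := expMeasure mu)).comp (measurePreserving_snd (μ := bernoulliMeasure true false half)
    (ν := (bernoulliMeasure true false p).prod (expMeasure mu))))).lintegral_comp hg.aemeasurable

variable [hlam : Fact (0 < lam)]

instance isProbabilityMeasure_markLaw {p : unitInterval} :
    IsProbabilityMeasure (markLaw lam p mu) := by
  unfold markLaw; infer_instance

lemma hasLaw_direction {p : unitInterval} :
    HasLaw (fun m : Mark => m.2.1) (bernoulliMeasure true false half) (markLaw lam p mu) :=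
  MeasurePreserving.hasLaw (measurePreserving_fst.comp measurePreserving_snd)

lemma hasLaw_breaks {p : unitInterval} :
    HasLaw (fun m : Mark => m.2.2.1) (bernoulliMeasure true false p) (markLaw lam p mu) :=
  MeasurePreserving.hasLaw
    (measurePreserving_fst.comp (measurePreserving_snd.comp measurePreserving_snd))

lemma hasLaw_repairTime {p : unitInterval} :
    HasLaw repairTime (expMeasure mu) (markLaw lam p mu) :=
  MeasurePreserving.hasLaw
    (measurePreserving_snd.comp (measurePreserving_snd.comp measurePreserving_snd))

lemma ae_good : ∀ᵐ m ∂markLaw lam 1 mu, m.Good := by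
  have h1 := (hasLaw_wait (lam := lam) (mu := mu) (p := 1)).ae_iff (p := fun x => 0 < x)
    (measurableSet_Ioi.mem)
  have h2 := (hasLaw_repairTime (lam := lam) (mu := mu) (p := 1)).ae_iff (p := fun x => 0 < x)
    (measurableSet_Ioi.mem)
  have h3 : ∀ᵐ m ∂markLaw lam 1 mu, m.2.2.1 = true := by
    have h := hasLaw_breaks (lam := lam) (mu := mu) (p := 1)
    rw [bernoulliMeasure_one] at h
    exact h.ae_eq_of_dirac
  filter_upwards [h1.2 (ae_pos_expMeasure hlam.out), h2.2 (ae_pos_expMeasure hmu.out), h3]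
    with m h1 h2 h3
  exact ⟨h1, h3, h2⟩

lemma measurable_firstStep : Measurable firstStep :=
  Measurable.ite (measurableSet_eq_fun (by fun_prop) measurable_const)
    measurable_const measurable_const

lemma integral_firstStep {p : unitInterval} :
    ∫ m, (firstStep m : ℝ) ∂markLaw lam p mu = 0 := by
  have h := (hasLaw_direction (lam := lam) (mu := mu) (p := p)).integral_comp
    (f := fun b : Bool => ((if b then 1 else -1 : ℤ) : ℝ)) (by fun_prop)
  refine h.trans ?_
  rw [integral_bernoulliMeasure]
  norm_num [half]

variable (lam mu) in
/-- The law of a sequence of independent marks. -/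
def pathLaw : Measure (ℕ → Mark) := Measure.infinitePi fun _ => markLaw lam 1 mu

instance isProbabilityMeasure_pathLaw : IsProbabilityMeasure (pathLaw lam mu) := by
  unfold pathLaw; infer_instance

lemma hasLaw_eval (n : ℕ) : HasLaw (fun d : ℕ → Mark => d n) (markLaw lam 1 mu) (pathLaw lam mu) :=
  (measurePreserving_eval_infinitePi (fun _ : ℕ => markLaw lam 1 mu) n).hasLaw

lemma iIndepFun_eval : iIndepFun (fun n (d : ℕ → Mark) => d n) (pathLaw lam mu) :=
  iIndepFun_infinitePi (X := fun _ x => x) fun _ => measurable_id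

lemma ae_forall_good : ∀ᵐ d ∂pathLaw lam mu, ∀ n, (d n).Good :=
  ae_all_iff.2 fun n =>
    (measurePreserving_eval_infinitePi (fun _ : ℕ => markLaw lam 1 mu) n).quasiMeasurePreserving.ae
      ae_good

lemma lintegral_prod_pathLaw (s : Finset ℕ) {f : ℕ → Mark → ℝ≥0∞} (hf : ∀ n, Measurable (f n)) :
    ∫⁻ d, ∏ j ∈ s, f j (d j) ∂pathLaw lam mu = ∏ j ∈ s, ∫⁻ m, f j m ∂markLaw lam 1 mu := by
  refine (lintegral_prod_eq_prod_lintegral_of_indepFun s (fun j (d : ℕ → Mark) => f j (d j))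
    (iIndepFun_eval.comp _ hf) fun j => (hf j).comp (measurable_pi_apply j)).trans ?_
  exact Finset.prod_congr rfl fun j _ => (hasLaw_eval j).lintegral_comp (hf j).aemeasurable

/-- Exponential moment of the workload, weighted by the next repair time. -/
lemma lintegral_exp_workload {θ : ℝ} (h0 : 0 < θ) (hθ : θ < mu) {h : ℝ → ℝ≥0∞} (hh : Measurable h)
    (n : ℕ) :
    ∫⁻ d, ENNReal.ofReal (Real.exp (θ * workload d n)) * h (repairTime (d n)) ∂pathLaw lam mu
      = ENNReal.ofReal (lam / (lam + θ) * (mu / (mu - θ))) ^ n * ∫⁻ x, h x ∂expMeasure mu := by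
  set F : ℕ → ℝ → ℝ≥0∞ := fun j x => if j = 0 then 1 else ENNReal.ofReal (Real.exp (-θ * x)) with hF
  set G : ℕ → ℝ → ℝ≥0∞ := fun j x => if j < n then ENNReal.ofReal (Real.exp (θ * x)) else h x with hG
  have mF : ∀ j, Measurable (F j) := fun j => by
    simp only [hF]; split_ifs <;> fun_prop
  have mG : ∀ j, Measurable (G j) := fun j => by
    simp only [hG]; split_ifs <;> fun_prop
  have mR := measurable_repairTime
  have key : ∀ d : ℕ → Mark, ENNReal.ofReal (Real.exp (θ * workload d n)) * h (repairTime (d n))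
      = ∏ j ∈ Finset.range (n + 1), F j (d j).1 * G j (repairTime (d j)) := by
    intro d
    rw [Finset.prod_mul_distrib, Finset.prod_range_succ', Finset.prod_range_succ (fun j => G j _)]
    have e1 : ∏ j ∈ Finset.range n, F (j + 1) (d (j + 1)).1
        = ENNReal.ofReal (Real.exp (∑ j ∈ Finset.range n, -θ * (d (j + 1)).1)) := by
      rw [Real.exp_sum, ENNReal.ofReal_prod_of_nonneg fun _ _ => (Real.exp_pos _).le]
      simp [hF]
    have e2 : ∏ j ∈ Finset.range n, G j (repairTime (d j))
        = ENNReal.ofReal (Real.exp (∑ j ∈ Finset.range n, θ * repairTime (d j))) := by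
      rw [Real.exp_sum, ENNReal.ofReal_prod_of_nonneg fun _ _ => (Real.exp_pos _).le]
      exact Finset.prod_congr rfl fun j hj => by simp [hG, Finset.mem_range.1 hj]
    rw [e1, e2, show F 0 (d 0).1 = 1 by simp [hF], mul_one,
      show G n (repairTime (d n)) = h (repairTime (d n)) by simp [hG], ← mul_assoc,
      ← ENNReal.ofReal_mul (Real.exp_pos _).le, ← Real.exp_add, ← Finset.sum_add_distrib, workload,
      Finset.mul_sum]
    congr 4
    funext j
    ring
  simp_rw [key]
  rw [lintegral_prod_pathLaw (f := fun j m => F j m.1 * G j (repairTime m)) _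
    fun j => ((mF j).comp measurable_fst).mul ((mG j).comp mR)]
  simp_rw [fun j => lintegral_markLaw (lam := lam) (mu := mu) (p := 1) (mF j) (mG j)]
  rw [Finset.prod_mul_distrib, Finset.prod_range_succ',
    Finset.prod_range_succ (fun j => ∫⁻ x, G j x ∂expMeasure mu)]
  have e1 : ∀ j, ∫⁻ x, F (j + 1) x ∂expMeasure lam = ENNReal.ofReal (lam / (lam + θ)) := fun j => by
    simp only [hF, Nat.add_eq_zero_iff, one_ne_zero, and_false, if_false]
    rw [lintegral_exp_expMeasure hlam.out (by linarith [hlam.out]), sub_neg_eq_add]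
  have e2 : ∏ j ∈ Finset.range n, ∫⁻ x, G j x ∂expMeasure mu
      = ENNReal.ofReal (mu / (mu - θ)) ^ n := by
    rw [Finset.prod_congr rfl (g := fun _ => ENNReal.ofReal (mu / (mu - θ)))]
    · simp
    · intro j hj
      simp only [hG, Finset.mem_range.1 hj, if_true]
      exact lintegral_exp_expMeasure hmu.out hθ
  have hl := hlam.out
  simp_rw [e1]
  rw [e2, ENNReal.ofReal_mul (by positivity), mul_pow]
  simp [hF, hG, mul_assoc]

variable (lam mu) in
/-- The decay rate of the tail of the busy period. -/
def decay : ℝ := 4 * lam / (2 * lam + mu)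

/-- The workload is nonnegative at index `n`. -/
def busyAt (n : ℕ) : Set (ℕ → Mark) := {d | 0 ≤ workload d n}

lemma measurableSet_busyAt (n : ℕ) : MeasurableSet (busyAt n) :=
  measurableSet_le measurable_const (measurable_workload n)

/-- Chernoff bound for the workload. -/
lemma lintegral_busyAt_le {h : ℝ → ℝ≥0∞} (hh : Measurable h) (n : ℕ) :
    ∫⁻ d, (busyAt n).indicator (fun d => h (repairTime (d n))) d ∂pathLaw lam mu
      ≤ ENNReal.ofReal (decay lam mu) ^ n * ∫⁻ x, h x ∂expMeasure mu := by
  have hl := hlam.out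
  have hm := hmu.out
  -- The Chernoff parameter is θ = mu / 2.
  have e : lam / (lam + mu / 2) * (mu / (mu - mu / 2)) = decay lam mu := by
    have : mu - mu / 2 ≠ 0 := by linarith
    unfold decay; field_simp; ring
  rw [← e, ← lintegral_exp_workload (by positivity) (by linarith) hh]
  refine lintegral_mono fun d => ?_
  by_cases hd : d ∈ busyAt n
  · rw [Set.indicator_of_mem hd]
    refine le_mul_of_one_le_left' ?_
    rw [ENNReal.one_le_ofReal]
    have : 0 ≤ workload d n := hd
    exact Real.one_le_exp (by positivity)
  · rw [Set.indicator_of_notMem hd]; exact zero_le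

lemma measure_busyAt_le (n : ℕ) :
    pathLaw lam mu (busyAt n) ≤ ENNReal.ofReal (decay lam mu) ^ n := by
  have h := lintegral_busyAt_le (lam := lam) (mu := mu) (h := fun _ => 1) measurable_const n
  simpa [lintegral_indicator (measurableSet_busyAt n)] using h

lemma hasLaw_wait_one_repair_zero :
    HasLaw (fun d : ℕ → Mark => ((d 1).1, repairTime (d 0)))
      ((expMeasure lam).prod (expMeasure mu)) (pathLaw lam mu) := by
  have hi : IndepFun (fun d : ℕ → Mark => d 1) (fun d => d 0) (pathLaw lam mu) :=
    iIndepFun_eval.indepFun one_ne_zero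
  have h1 : HasLaw (fun d : ℕ → Mark => (d 1).1) (expMeasure lam) (pathLaw lam mu) :=
    hasLaw_wait.fun_comp (hasLaw_eval 1)
  have h0 : HasLaw (fun d : ℕ → Mark => repairTime (d 0)) (expMeasure mu) (pathLaw lam mu) :=
    hasLaw_repairTime.fun_comp (hasLaw_eval 0)
  exact (indepFun_iff_hasLaw_prodMk_prod h1 h0).1
    (hi.comp (φ := fun m : Mark => m.1) (ψ := repairTime) measurable_fst measurable_repairTime)

lemma measure_busyAt_one :
    pathLaw lam mu (busyAt 1) = ENNReal.ofReal (lam / (lam + mu)) := by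
  rw [← prod_expMeasure_le hlam.out hmu.out, ← hasLaw_wait_one_repair_zero.measure_eq
    (p := fun z => z.1 ≤ z.2) (measurableSet_le measurable_fst measurable_snd)]
  congr 1
  ext d
  simp [busyAt, workload]

lemma measure_workload_one_pos :
    pathLaw lam mu {d | 0 < workload d 1} = ENNReal.ofReal (lam / (lam + mu)) := by
  rw [← prod_expMeasure_lt hlam.out hmu.out, ← hasLaw_wait_one_repair_zero.measure_eq
    (p := fun z => z.1 < z.2) (measurableSet_lt measurable_fst measurable_snd)]
  congr 1
  ext d
  simp [workload]

lemma lintegral_attemptTime_zero :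
    ∫⁻ d, ENNReal.ofReal (attemptTime d 0) ∂pathLaw lam mu = ENNReal.ofReal (1 / lam) := by
  simp_rw [attemptTime_zero]
  rw [← lintegral_id_expMeasure hlam.out]
  exact ((hasLaw_wait (mu := mu) (p := 1)).fun_comp (hasLaw_eval 0)).lintegral_comp
    (f := ENNReal.ofReal) (by fun_prop)

/-- Almost surely the first busy period ends. -/
lemma ae_exists_isFirstIdle (hr : decay lam mu < 1) :
    ∀ᵐ d ∂pathLaw lam mu, ∃ n, IsFirstIdle d n := by
  -- Borel–Cantelli: the workload is eventually negative.
  have hs : ∑' n, pathLaw lam mu (busyAt n) ≠ ∞ := by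
    refine ne_top_of_le_ne_top ?_ (ENNReal.tsum_le_tsum fun n => measure_busyAt_le n)
    rw [ENNReal.tsum_geometric]
    rw [ENNReal.inv_ne_top, Ne, tsub_eq_zero_iff_le, not_le]
    exact ENNReal.ofReal_lt_one.2 hr
  filter_upwards [ae_eventually_notMem hs] with d hd
  have hex : ∃ n, workload d n < 0 := by
    obtain ⟨n, hn⟩ := hd.exists
    exact ⟨n, not_le.1 hn⟩
  classical
  refine ⟨Nat.find hex, ?_, Nat.find_spec hex, fun i hi => not_lt.1 (Nat.find_min hex hi)⟩
  by_contra h0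
  have h1 := Nat.find_spec hex
  rw [show Nat.find hex = 0 by omega] at h1
  simp [workload] at h1

end

/-! ### Pathwise bounds by indicators, free of the random index n -/

lemma ofReal_tau_le (hd : ∀ n, (d n).Good) {n : ℕ} (hn : IsFirstIdle d n) :
    ENNReal.ofReal (tau d 1).toReal ≤ ENNReal.ofReal (attemptTime d 0)
      + ∑' i, (busyAt i).indicator (fun d => ENNReal.ofReal (repairTime (d i))) d := by
  have h0 : 0 ≤ attemptTime d 0 := by rw [attemptTime_zero]; exact (hd 0).1.le
  refine (ENNReal.ofReal_le_ofReal (toReal_tau_le hd hn)).trans ?_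
  rw [repairTotal, ENNReal.ofReal_add h0 (Finset.sum_nonneg fun j _ => (hd j).2.2.le),
    ENNReal.ofReal_sum_of_nonneg fun j _ => (hd j).2.2.le]
  refine add_le_add_right (le_trans (Finset.sum_le_sum fun i hi => ?_)
    (ENNReal.sum_le_tsum (Finset.range n))) _
  exact (Set.indicator_of_mem (show d ∈ busyAt i from hn.2.2 i (Finset.mem_range.1 hi))
    (fun d : ℕ → Mark => ENNReal.ofReal (repairTime (d i)))).ge

/-- Turns n² into a sum over i < n of geometric weights, which stay summable against the tail once 3
* `decay` < 1. -/
lemma sq_le_sum_pow_three (n : ℕ) : n ^ 2 ≤ ∑ i ∈ Finset.range n, 3 ^ i := by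
  have h : ∀ m : ℕ, 2 * m + 1 ≤ 3 ^ m := fun m => by
    induction m with
    | zero => simp
    | succ m ih => rw [pow_succ]; omega
  induction n with
  | zero => simp
  | succ n ih => rw [Finset.sum_range_succ]; nlinarith [h n]

lemma ofReal_endPos_sq_le (hd : ∀ n, (d n).Good) {n : ℕ} (hn : IsFirstIdle d n) :
    ENNReal.ofReal ((endPos d : ℝ) ^ 2) ≤ ∑' i, (busyAt i).indicator (fun _ => (3 : ℝ≥0∞) ^ i) d := by
  have h1 : (endPos d : ℝ) ^ 2 ≤ ((∑ i ∈ Finset.range n, 3 ^ i : ℕ) : ℝ) := by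
    rw [← sq_abs]
    have h : |(endPos d : ℝ)| ≤ n := by exact_mod_cast abs_endPos_le hd hn
    have h2 : ((n ^ 2 : ℕ) : ℝ) ≤ ((∑ i ∈ Finset.range n, 3 ^ i : ℕ) : ℝ) :=
      Nat.cast_le.2 (sq_le_sum_pow_three n)
    refine le_trans ?_ h2
    push_cast
    gcongr
  refine (ENNReal.ofReal_le_ofReal h1).trans ?_
  rw [ENNReal.ofReal_natCast]
  push_cast
  refine le_trans (Finset.sum_le_sum fun i hi => ?_) (ENNReal.sum_le_tsum (Finset.range n))
  exact (Set.indicator_of_mem (show d ∈ busyAt i from hn.2.2 i (Finset.mem_range.1 hi))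
    (fun _ => (3 : ℝ≥0∞) ^ i)).ge

lemma abs_firstStep (m : Mark) : |(firstStep m : ℝ)| = 1 := by
  unfold firstStep; split_ifs <;> simp

/-- The difference vanishes off `busyAt 1`. On it, the bound n + 1 = 2 + (n - 1) is counted by the
busy indices 1, …, n - 1. -/
lemma enorm_endPos_sub_firstStep_le (hd : ∀ n, (d n).Good) {n : ℕ} (hn : IsFirstIdle d n) :
    ‖(endPos d : ℝ) - firstStep (d 0)‖ₑ ≤ (busyAt 1).indicator (fun _ => 2) d
      + ∑' i, (busyAt (i + 1)).indicator (fun _ => (1 : ℝ≥0∞)) d := by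
  by_cases h1 : d ∈ busyAt 1
  · have hn2 : 2 ≤ n := by
      have hne : n ≠ 1 := by
        rintro rfl
        exact (not_le.2 hn.2.1) h1
      have := hn.1
      omega
    have hb : |(endPos d : ℝ) - firstStep (d 0)| ≤ ((2 + (n - 1) : ℕ) : ℝ) := by
      have h : |(endPos d : ℝ)| ≤ n := by exact_mod_cast abs_endPos_le hd hn
      have := abs_sub (endPos d : ℝ) (firstStep (d 0))
      rw [abs_firstStep] at this
      rw [show 2 + (n - 1) = n + 1 by omega]
      push_cast
      linarith
    rw [Real.enorm_eq_ofReal_abs, Set.indicator_of_mem h1]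
    refine (ENNReal.ofReal_le_ofReal hb).trans ?_
    rw [ENNReal.ofReal_natCast]
    push_cast
    refine add_le_add_right (le_trans ?_ (ENNReal.sum_le_tsum (Finset.range (n - 1)))) _
    rw [Finset.sum_congr rfl (g := fun _ => 1)]
    · simp
    · intro i hi
      exact Set.indicator_of_mem (show d ∈ busyAt (i + 1) from
        hn.2.2 _ (by have := Finset.mem_range.1 hi; omega)) _
  · rw [endPos_eq_firstStep hd (not_le.1 h1)]
    simp

/-- A lower bound for the square of the position by indicators. -/
lemma le_endPos_sq (hd : ∀ n, (d n).Good) :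
    1 - (busyAt 1).indicator 1 d + 4 * {d | 0 < workload d 1}.indicator 1 d
      - 4 * (busyAt 2).indicator 1 d ≤ (endPos d : ℝ) ^ 2 := by
  have hsq := sq_nonneg (endPos d : ℝ)
  have hB : (0 : ℝ) ≤ (busyAt 2).indicator 1 d := Set.indicator_nonneg (by simp) _
  by_cases h1 : d ∈ busyAt 1
  · rw [Set.indicator_of_mem h1]
    -- On `busyAt 2` the left side is at most 1 - 1 + 4 - 4 = 0, so nothing need be known about
    -- longer cycles.
    by_cases h2 : d ∈ busyAt 2
    · rw [Set.indicator_of_mem h2]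
      have : {d : ℕ → Mark | 0 < workload d 1}.indicator (1 : (ℕ → Mark) → ℝ) d ≤ 1 :=
        Set.indicator_le_self' (by simp) d
      simp only [Pi.one_apply] at *
      linarith
    · rw [Set.indicator_of_notMem h2]
      -- The forced second jump requires strict positivity; a tie leaves 0 on the left, and ties
      -- have probability 0.
      by_cases h3 : 0 < workload d 1
      · rw [Set.indicator_of_mem (show d ∈ {d | 0 < workload d 1} from h3)]
        have h : |(endPos d : ℝ)| = 2 := by
          exact_mod_cast abs_endPos_eq_two hd h3 (not_le.1 h2)
        rw [← sq_abs, h]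
        norm_num
      · rw [Set.indicator_of_notMem (show d ∉ {d | 0 < workload d 1} from h3)]
        simp only [Pi.one_apply]
        linarith
  · have h3 : d ∉ {d : ℕ → Mark | 0 < workload d 1} := fun h =>
    h1 (show 0 ≤ workload d 1 from le_of_lt h)
    rw [endPos_eq_firstStep hd (not_le.1 h1), ← sq_abs, abs_firstStep,
      Set.indicator_of_notMem h1, Set.indicator_of_notMem h3]
    linarith

/-! ### Moment estimates for τ_1 and X(τ_1) -/

section

variable {lam mu : ℝ} [hmu : Fact (0 < mu)] [hlam : Fact (0 < lam)]

lemma aemeasurable_tau : AEMeasurable (fun d => (tau d 1).toReal) (pathLaw lam mu) :=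
  measurable_tauRat.ennreal_toReal.aemeasurable.congr <| by
    filter_upwards [ae_forall_good] with d hd
    rw [tau_one_eq_tauRat hd]

lemma aemeasurable_endPos : AEMeasurable (fun d => (endPos d : ℝ)) (pathLaw lam mu) :=
  ((measurable_from_top (f := fun k : ℤ => (k : ℝ))).comp measurable_endPosRat).aemeasurable.congr <| by
    filter_upwards [ae_forall_good] with d hd
    rw [endPos_eq_endPosRat hd]; rfl

lemma decay_nonneg : 0 ≤ decay lam mu := by
  have := hlam.out
  have := hmu.out
  unfold decay; positivity

lemma tsum_decay (hr : decay lam mu < 1) :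
    ∑' n, ENNReal.ofReal (decay lam mu) ^ n = ENNReal.ofReal (1 / (1 - decay lam mu)) := by
  rw [ENNReal.tsum_geometric, one_div, ENNReal.ofReal_inv_of_pos (by linarith),
    ENNReal.ofReal_sub _ decay_nonneg, ENNReal.ofReal_one]

/-- The first wait gives 1 / lam. Repair i is independent of the workload at i, so its term is at
most `decay` ^ i / mu. -/
lemma lintegral_tau_le (hr : decay lam mu < 1) :
    ∫⁻ d, ENNReal.ofReal (tau d 1).toReal ∂pathLaw lam mu
      ≤ ENNReal.ofReal (1 / lam + 1 / (1 - decay lam mu) * (1 / mu)) := by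
  have hl := hlam.out
  have hm := hmu.out
  have hr' : 0 < 1 - decay lam mu := by linarith
  calc _ ≤ ∫⁻ d, (ENNReal.ofReal (attemptTime d 0)
        + ∑' i, (busyAt i).indicator (fun d => ENNReal.ofReal (repairTime (d i))) d)
          ∂pathLaw lam mu := by
        refine lintegral_mono_ae ?_
        filter_upwards [ae_forall_good, ae_exists_isFirstIdle hr] with d hd ⟨n, hn⟩
        exact ofReal_tau_le hd hn
    _ = ENNReal.ofReal (1 / lam) + ∑' i, ∫⁻ d, (busyAt i).indicator
          (fun d => ENNReal.ofReal (repairTime (d i))) d ∂pathLaw lam mu := by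
        rw [lintegral_add_left (measurable_attemptTime 0).ennreal_ofReal,
          lintegral_attemptTime_zero, lintegral_tsum]
        exact fun i => ((measurable_repairTime.comp (measurable_pi_apply i)).ennreal_ofReal.indicator
          (measurableSet_busyAt i)).aemeasurable
    _ ≤ ENNReal.ofReal (1 / lam) + ∑' i, ENNReal.ofReal (decay lam mu) ^ i
          * ENNReal.ofReal (1 / mu) := by
        gcongr with i
        rw [← lintegral_id_expMeasure hm]
        exact lintegral_busyAt_le ENNReal.measurable_ofReal i
    _ = _ := by
        rw [ENNReal.tsum_mul_right, tsum_decay hr, ← ENNReal.ofReal_mul (by positivity),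
          ← ENNReal.ofReal_add (by positivity) (by positivity)]

lemma integrable_tau (hr : decay lam mu < 1) :
    Integrable (fun d => (tau d 1).toReal) (pathLaw lam mu) := by
  refine ⟨aemeasurable_tau.aestronglyMeasurable, ?_⟩
  rw [hasFiniteIntegral_iff_ofReal (.of_forall fun _ => ENNReal.toReal_nonneg)]
  exact (lintegral_tau_le hr).trans_lt ENNReal.ofReal_lt_top

lemma integral_tau_le (hr : decay lam mu < 1) :
    ∫ d, (tau d 1).toReal ∂pathLaw lam mu ≤ 1 / lam + 1 / (1 - decay lam mu) * (1 / mu) := by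
  have hl := hlam.out
  have hm := hmu.out
  have hr' : 0 < 1 - decay lam mu := by linarith
  rw [integral_eq_lintegral_of_nonneg_ae (.of_forall fun _ => ENNReal.toReal_nonneg)
    aemeasurable_tau.aestronglyMeasurable]
  exact ENNReal.toReal_le_of_le_ofReal (by positivity) (lintegral_tau_le hr)

lemma integral_tau_pos (hr : decay lam mu < 1) : 0 < ∫ d, (tau d 1).toReal ∂pathLaw lam mu := by
  refine (integral_nonneg fun _ => ENNReal.toReal_nonneg).lt_of_ne' fun h => ?_
  rw [integral_eq_zero_iff_of_nonneg (fun _ => ENNReal.toReal_nonneg) (integrable_tau hr)] at h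
  obtain ⟨d, hd, ⟨n, hn⟩, h0⟩ :=
    ((ae_forall_good (lam := lam) (mu := mu)).and ((ae_exists_isFirstIdle hr).and h)).exists
  have h1 := attemptTime_zero_le_toReal_tau hd hn
  rw [attemptTime_zero] at h1
  exact ((hd 0).1.trans_le h1).ne' h0

lemma memLp_endPos (hr : 3 * decay lam mu < 1) :
    MemLp (fun d => (endPos d : ℝ)) 2 (pathLaw lam mu) := by
  have hr0 := decay_nonneg (lam := lam) (mu := mu)
  rw [memLp_two_iff_integrable_sq aemeasurable_endPos.aestronglyMeasurable]
  refine ⟨(aemeasurable_endPos.pow_const 2).aestronglyMeasurable, ?_⟩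
  rw [hasFiniteIntegral_iff_ofReal (.of_forall fun _ => sq_nonneg _)]
  calc _ ≤ ∫⁻ d, ∑' i, (busyAt i).indicator (fun _ => (3 : ℝ≥0∞) ^ i) d ∂pathLaw lam mu := by
        refine lintegral_mono_ae ?_
        filter_upwards [ae_forall_good, ae_exists_isFirstIdle (by linarith)] with d hd ⟨n, hn⟩
        exact ofReal_endPos_sq_le hd hn
    _ = ∑' i, 3 ^ i * pathLaw lam mu (busyAt i) := by
        rw [lintegral_tsum fun i => (measurable_const.indicator (measurableSet_busyAt i)).aemeasurable]
        simp [lintegral_indicator (measurableSet_busyAt _)]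
    _ ≤ ∑' i, ENNReal.ofReal (3 * decay lam mu) ^ i := by
        refine ENNReal.tsum_le_tsum fun i => ?_
        rw [ENNReal.ofReal_mul (by norm_num), mul_pow, ENNReal.ofReal_ofNat]
        gcongr
        exact measure_busyAt_le i
    _ < ∞ := by
        rw [ENNReal.tsum_geometric, ENNReal.inv_lt_top, tsub_pos_iff_lt]
        exact ENNReal.ofReal_lt_one.2 hr

/-- The first step is centred and differs from X(τ_1) only on `busyAt 1`. A bound of order `decay`
suffices, as the mean enters the variance squared; no reflection argument is needed. -/
lemma abs_integral_endPos_le (hr : 3 * decay lam mu < 1) :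
    |∫ d, (endPos d : ℝ) ∂pathLaw lam mu|
      ≤ 2 * decay lam mu + decay lam mu * (1 / (1 - decay lam mu)) := by
  have hr0 := decay_nonneg (lam := lam) (mu := mu)
  have hr1 : decay lam mu < 1 := by linarith
  have hr' : 0 < 1 - decay lam mu := by linarith
  have hX : Integrable (fun d => (endPos d : ℝ)) (pathLaw lam mu) :=
    (memLp_endPos hr).integrable (by norm_num)
  have hstep : Measurable fun d : ℕ → Mark => (firstStep (d 0) : ℝ) :=
    (measurable_from_top (f := fun k : ℤ => (k : ℝ))).comp
      (measurable_firstStep.comp (measurable_pi_apply 0))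
  have hε : Integrable (fun d : ℕ → Mark => (firstStep (d 0) : ℝ)) (pathLaw lam mu) :=
    .of_bound hstep.aestronglyMeasurable 1 (.of_forall fun d => (abs_firstStep (d 0)).le)
  have h0 : ∫ d, (firstStep (d 0) : ℝ) ∂pathLaw lam mu = 0 := by
    rw [← integral_firstStep (lam := lam) (mu := mu) (p := 1)]
    exact (hasLaw_eval 0).integral_comp (f := fun m => (firstStep m : ℝ))
      ((measurable_from_top (f := fun k : ℤ => (k : ℝ))).comp
        measurable_firstStep).aestronglyMeasurable
  have e : ∫ d, (endPos d : ℝ) ∂pathLaw lam mu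
      = ∫ d, ((endPos d : ℝ) - firstStep (d 0)) ∂pathLaw lam mu := by
    rw [integral_sub hX hε, h0, sub_zero]
  rw [e, ← ENNReal.ofReal_le_ofReal_iff (by positivity), ← Real.enorm_eq_ofReal_abs]
  calc _ ≤ ∫⁻ d, ‖(endPos d : ℝ) - firstStep (d 0)‖ₑ ∂pathLaw lam mu :=
        enorm_integral_le_lintegral_enorm _
    _ ≤ ∫⁻ d, ((busyAt 1).indicator (fun _ => 2) d
          + ∑' i, (busyAt (i + 1)).indicator (fun _ => (1 : ℝ≥0∞)) d) ∂pathLaw lam mu := by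
        refine lintegral_mono_ae ?_
        filter_upwards [ae_forall_good, ae_exists_isFirstIdle hr1] with d hd ⟨n, hn⟩
        exact enorm_endPos_sub_firstStep_le hd hn
    _ = 2 * pathLaw lam mu (busyAt 1) + ∑' i, pathLaw lam mu (busyAt (i + 1)) := by
        rw [lintegral_add_left (measurable_const.indicator (measurableSet_busyAt 1)),
          lintegral_tsum fun i =>
            (measurable_const.indicator (measurableSet_busyAt (i + 1))).aemeasurable]
        simp [lintegral_indicator (measurableSet_busyAt _)]
    _ ≤ 2 * ENNReal.ofReal (decay lam mu) ^ 1
          + ∑' i, ENNReal.ofReal (decay lam mu) * ENNReal.ofReal (decay lam mu) ^ i := by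
        gcongr with i
        · exact measure_busyAt_le 1
        · rw [← pow_succ']; exact measure_busyAt_le (i + 1)
    _ = _ := by
        rw [ENNReal.tsum_mul_left, tsum_decay hr1, ← ENNReal.ofReal_mul hr0, pow_one,
          ← ENNReal.ofReal_ofNat 2, ← ENNReal.ofReal_mul (by norm_num),
          ← ENNReal.ofReal_add (by positivity) (by positivity)]

lemma le_integral_endPos_sq (hr : 3 * decay lam mu < 1) :
    1 + 3 * (lam / (lam + mu)) - 4 * decay lam mu ^ 2
      ≤ ∫ d, (endPos d : ℝ) ^ 2 ∂pathLaw lam mu := by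
  have hl := hlam.out
  have hm := hmu.out
  have hr0 := decay_nonneg (lam := lam) (mu := mu)
  have hpos : MeasurableSet {d | 0 < workload d 1} :=
    measurableSet_lt measurable_const (measurable_workload 1)
  have hi : ∀ {s : Set (ℕ → Mark)}, MeasurableSet s →
      Integrable (s.indicator (1 : (ℕ → Mark) → ℝ)) (pathLaw lam mu) := fun hs =>
    (integrable_const (1 : ℝ)).indicator hs
  have hle := integral_mono_ae (μ := pathLaw lam mu)
    ((((integrable_const (1 : ℝ)).sub (hi (measurableSet_busyAt 1))).add
      ((hi hpos).const_mul 4)).sub ((hi (measurableSet_busyAt 2)).const_mul 4))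
    (memLp_endPos hr).integrable_sq
    (by filter_upwards [ae_forall_good] with d hd using le_endPos_sq hd)
  refine le_trans ?_ hle
  have h2 : (pathLaw lam mu).real (busyAt 2) ≤ decay lam mu ^ 2 := by
    refine ENNReal.toReal_le_of_le_ofReal (by positivity) ?_
    rw [ENNReal.ofReal_pow hr0]
    exact measure_busyAt_le 2
  have h1 : (pathLaw lam mu).real (busyAt 1) = lam / (lam + mu) := by
    rw [measureReal_def, measure_busyAt_one, ENNReal.toReal_ofReal (by positivity)]
  have h3 : (pathLaw lam mu).real {d | 0 < workload d 1} = lam / (lam + mu) := by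
    rw [measureReal_def, measure_workload_one_pos, ENNReal.toReal_ofReal (by positivity)]
  rw [integral_sub' (((integrable_const (1 : ℝ)).sub (hi (measurableSet_busyAt 1))).add
      ((hi hpos).const_mul 4)) ((hi (measurableSet_busyAt 2)).const_mul 4),
    integral_add' ((integrable_const (1 : ℝ)).sub (hi (measurableSet_busyAt 1)))
      ((hi hpos).const_mul 4), integral_sub' (integrable_const _) (hi (measurableSet_busyAt 1)),
    integral_const_mul, integral_const_mul, integral_indicator_one (measurableSet_busyAt 1),
    integral_indicator_one (measurableSet_busyAt 2), integral_indicator_one hpos, h1, h3]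
  simp only [integral_const, probReal_univ, smul_eq_mul]
  linarith

end

/-! ### Numerical comparison, transfer to any driving sequence, conclusion -/

/-- The numerical comparison of the estimates, in terms of the ratio `x = lam / mu`. -/
lemma ratio_estimate {x r : ℝ} (hx : 0 < x) (hx' : x < 1 / 1000) (hr0 : 0 ≤ r) (hr : r ≤ 4 * x) :
    1 + 1 / (1 - r) * x + (2 * r + r * (1 / (1 - r))) ^ 2 < 1 + 3 * (x / (1 + x)) - 4 * r ^ 2 := by
  have h1 : 1 / (1 - r) ≤ 1.01 := by
    rw [div_le_iff₀ (by linarith)]; linarith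
  have h2 : 0.99 * x ≤ x / (1 + x) := by
    rw [le_div_iff₀ (by linarith)]; nlinarith
  have h0 : 0 ≤ 1 / (1 - r) := by
    have : 0 < 1 - r := by linarith
    positivity
  -- At most 3.01 r, hence at most 12.04 x.
  have h3 : 2 * r + r * (1 / (1 - r)) ≤ 13 * x := by nlinarith
  have h4 : (2 * r + r * (1 / (1 - r))) ^ 2 ≤ (13 * x) ^ 2 := by
    have : 0 ≤ 2 * r + r * (1 / (1 - r)) := by positivity
    gcongr
  have h5 : r ^ 2 ≤ (4 * x) ^ 2 := by gcongr
  have h6 : x ^ 2 ≤ x / 1000 := by nlinarith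
  -- It remains that 1.01 x + 169 x² < 2.97 x - 64 x², where 233 x² ≤ 0.233 x.
  nlinarith

/-- Reduces every driving sequence to the canonical space, where all estimates are made. -/
lemma hasLaw_path {Ω : Type*} [MeasurableSpace Ω] {P : Measure Ω} [IsProbabilityMeasure P]
    {lam mu : ℝ} [Fact (0 < lam)] [Fact (0 < mu)] {D : ℕ → Ω → Mark} (hD : IsDriving P lam 1 mu D) :
    HasLaw (fun ω n => D n ω) (pathLaw lam mu) P where
  aemeasurable := aemeasurable_pi_iff.2 fun n => (hD.law n).aemeasurable
  map_eq := by
    rw [(iIndepFun_iff_map_fun_eq_infinitePi_map₀' fun n => (hD.law n).aemeasurable).1 hD.indep,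
      pathLaw]
    simp only [(hD.law _).map_eq]

end CollapsingBonds

end

open CollapsingBonds in
theorem mainTheorem3 (lam : ℝ) (hlam : 0 < lam) :
    ∃ mu₀ : ℝ, 0 < mu₀ ∧ ∀ mu : ℝ, mu₀ < mu →
      ∀ {Ω : Type*} [MeasurableSpace Ω] (P : Measure Ω) [IsProbabilityMeasure P]
        (D : ℕ → Ω → CollapsingBonds.Mark),
        CollapsingBonds.IsDriving P lam 1 mu D →
          (∀ᵐ ω ∂P, CollapsingBonds.tau (fun n => D n ω) 1 < ∞) ∧
          Integrable (CollapsingBonds.tauOne D) P ∧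
          MemLp (CollapsingBonds.walkAtTauOne D) 2 P ∧
          lam * ∫ ω, CollapsingBonds.tauOne D ω ∂P
            < ∫ ω, (CollapsingBonds.walkAtTauOne D ω) ^ 2 ∂P ∧
          (lam = 1 →
            1 < CollapsingBonds.beta P D / Real.sqrt (CollapsingBonds.alpha P D)) := by
  -- The factor 1000 is the smallness of lam / mu required by `ratio_estimate`.
  refine ⟨1000 * lam, by positivity, fun mu hmu Ω _ P _ D hD => ?_⟩
  have hmu0 : 0 < mu := by linarith
  have : Fact (0 < lam) := ⟨hlam⟩
  have : Fact (0 < mu) := ⟨hmu0⟩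
  have hr0 := decay_nonneg (lam := lam) (mu := mu)
  have hx' : lam / mu < 1 / 1000 := by rw [div_lt_div_iff₀ hmu0 (by norm_num)]; linarith
  have hrx : decay lam mu ≤ 4 * (lam / mu) := by
    rw [decay, ← mul_div_assoc]
    gcongr
    linarith
  have hest := ratio_estimate (by positivity : 0 < lam / mu) hx' hr0 hrx
  have hr3 : 3 * decay lam mu < 1 := by linarith
  have hr1 : decay lam mu < 1 := by linarith
  have hq : lam / mu / (1 + lam / mu) = lam / (lam + mu) := by field_simp; ring
  have hlaw := hasLaw_path hD
  have hPm := hlaw.map_eq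
  have hPa := hlaw.aemeasurable
  have hτ := integrable_tau hr1
  have hX := memLp_endPos hr3
  have hXsq := hX.integrable_sq
  have hτle : lam * ∫ d, (tau d 1).toReal ∂pathLaw lam mu
      ≤ 1 + 1 / (1 - decay lam mu) * (lam / mu) := by
    calc _ ≤ lam * (1 / lam + 1 / (1 - decay lam mu) * (1 / mu)) :=
          mul_le_mul_of_nonneg_left (integral_tau_le hr1) hlam.le
      _ = _ := by
          have : 1 - decay lam mu ≠ 0 := by linarith
          field_simp
  have hXge := le_integral_endPos_sq hr3
  have hmean := abs_integral_endPos_le hr3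
  have eτ : ∫ ω, tauOne D ω ∂P = ∫ d, (tau d 1).toReal ∂pathLaw lam mu :=
    hlaw.integral_comp (f := fun d => (tau d 1).toReal) hτ.aestronglyMeasurable
  have eX : ∫ ω, walkAtTauOne D ω ∂P = ∫ d, (endPos d : ℝ) ∂pathLaw lam mu :=
    hlaw.integral_comp (f := fun d => (endPos d : ℝ)) hX.aestronglyMeasurable
  have eX2 : ∫ ω, walkAtTauOne D ω ^ 2 ∂P = ∫ d, (endPos d : ℝ) ^ 2 ∂pathLaw lam mu :=
    hlaw.integral_comp (f := fun d => (endPos d : ℝ) ^ 2) hXsq.aestronglyMeasurable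
  have hmem : MemLp (walkAtTauOne D) 2 P := by
    rw [← hPm] at hX
    exact hX.comp_of_map hPa
  have hsqmean : (∫ d, (endPos d : ℝ) ∂pathLaw lam mu) ^ 2
      ≤ (2 * decay lam mu + decay lam mu * (1 / (1 - decay lam mu))) ^ 2 := by
    rw [← sq_abs]
    gcongr
  rw [hq] at hest
  refine ⟨?_, ?_, hmem, ?_, fun h1 => ?_⟩
  · have h : ∀ᵐ d ∂pathLaw lam mu, tau d 1 < ∞ := by
      filter_upwards [ae_forall_good, ae_exists_isFirstIdle hr1] with d hd ⟨n, hn⟩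
      exact tau_lt_top hd hn
    rw [← hPm] at h
    exact ae_of_ae_map hPa h
  · rw [← hPm] at hτ
    exact hτ.comp_aemeasurable hPa
  · rw [eτ, eX2]
    linarith [sq_nonneg (2 * decay lam mu + decay lam mu * (1 / (1 - decay lam mu)))]
  · have hα : 0 < alpha P D := by
      rw [alpha, eτ]; exact integral_tau_pos hr1
    rw [CollapsingBonds.beta, one_lt_div (Real.sqrt_pos.2 hα)]
    refine Real.sqrt_lt_sqrt hα.le ?_
    -- The squared mean subtracted here is absorbed by the square term in `ratio_estimate`.
    rw [variance_eq_sub hmem]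
    simp only [Pi.pow_apply]
    rw [alpha, eτ, eX, eX2]
    rw [h1, one_mul] at hτle
    subst h1
    linarith
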